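/- For a complex number $x$ and integers $\ell \ge 1$, $m\ge 0$ put $$H_m^{\langle \ell\rangle}(x)=\sum_{k=1}^m\frac{1}{(x+k)^\ell},\qquad H_m(x)=H_m^{\langle 1\rangle}(x),\qquad \binom{x}{m}=\frac{x(x-1)\cdots(x-m+1)}{m!}.$$ Let $n\ge 2$ be an integer and let $x$ be a complex number with $x\notin\{-1,-2,\dots,-(2n+1)\}$ and $xn+3n+1\neq 0$ (so that no denominator below vanishes). Then $$\begin{aligned} \sum_{k=0}^n\binom{2n-k}{n}\binom{x+k}{k}k^2H_k(x)^2 ={}&\frac{(x+1)(xn+3n+1)}{8(n-1)}\binom{x+2n+1}{n-2}\\ &\times\Big\{8\big[H_{n+3}(x)-H_{2n+1}(x)\big]\Big[H_{n+3}(x)-H_{2n+1}(x)-\frac{2(2xn+4n+1)}{(x+1)(xn+3n+1)}\Big]\\ &\quad-\Big[H_n\big(\tfrac{x}{2}\big)-H_{n+1}\big(\tfrac{x-1}{2}\big)\Big]\Big[H_n\big(\tfrac{x}{2}\big)-H_{n+1}\big(\tfrac{x-1}{2}\big)-\frac{4(x+n+1)(x^2+3x-2n+1)}{n(x+1)(xn+3n+1)}\Big]\\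 &\quad+8H_{n+3}^{\langle 2\rangle}(x)-4H_{2n+1}^{\langle 2\rangle}(x)+\frac{8(x^2+3x+3n^2-n+1)}{n(x+1)(xn+3n+1)}\Big\}. \end{aligned}$$ -/

import Mathlib

/-- The generalized harmonic number of order `ℓ`:
`H_n^{⟨ℓ⟩}(x) = ∑_{k=1}^n 1 / (x + k)^ℓ`, which is `0` for `n = 0`. -/
noncomputable def genHarmonicOrd (ℓ n : ℕ) (x : ℂ) : ℂ :=
  ∑ k ∈ Finset.Icc 1 n, 1 / (x + (k : ℂ)) ^ ℓ

/-- The generalized harmonic number (of order one) `H_n(x) = ∑_{k=1}^n 1 / (x + k)`. -/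
noncomputable def genHarmonic (n : ℕ) (x : ℂ) : ℂ :=
  genHarmonicOrd 1 n x

/-! Split `H_k² = (H_k² - H_k^⟨2⟩) + H_k^⟨2⟩`; the two pieces obey different difference equations
and are summed separately.

The functions `1`, `H_k`, `H_k² - H_k^⟨2⟩` satisfy `(x+k+1)(f(k+1) - f(k)) = e(k)` with `e = 0`,
`1`, `2 H_k`: they are the successive `x`-derivatives of `binom (x+k) k` divided by `binom (x+k) k`.
Their zeroth moments are correspondingly `binom (x+2n+1) n` and its first two derivatives, but the
proof replaces differentiation by induction on `n`. Abel summation (`sum_telescope`) expresses the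
higher moments through the zeroth, and contiguity of the weights in `(m, N)` gives the recurrence
`moment_step_first`.

For `H_k^⟨2⟩` the difference equation carries `(x+k+1)²`. One relation then couples moments 0, 1 and
2, so moments 0 and 1 must be carried together (`moment_step_second`, `moment_genHarmonicOrd_two`).
This is where the alternating sum `altHarmonic` enters.

In both cases the second moment follows from the lower ones, and adding the two pieces gives the
theorem. -/

/-- The binomial coefficient `binom (x + k) k` as the product `∏_{j=1}^k (x + j) / j`. -/
noncomputable def risingBinom (x : ℂ) (k : ℕ) : ℂ :=
  ∏ j ∈ Finset.range k, (x + j + 1) / ((j : ℂ) + 1)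

lemma risingBinom_zero (x : ℂ) : risingBinom x 0 = 1 := by simp [risingBinom]

lemma risingBinom_succ (x : ℂ) (k : ℕ) :
    risingBinom x (k + 1) = risingBinom x k * ((x + k + 1) / ((k : ℂ) + 1)) := by
  exact Finset.prod_range_succ _ k

lemma succ_mul_risingBinom_succ (x : ℂ) (k : ℕ) :
    ((k : ℂ) + 1) * risingBinom x (k + 1) = (x + k + 1) * risingBinom x k := by
  have : (k : ℂ) + 1 ≠ 0 := Nat.cast_add_one_ne_zero k
  rw [risingBinom_succ]
  field_simp

lemma risingBinom_shift (x : ℂ) (k : ℕ) :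
    (x + 1) * risingBinom (x + 1) k = (x + k + 1) * risingBinom x k := by
  induction k with
  | zero => simp [risingBinom_zero]
  | succ k ih =>
    rw [risingBinom_succ, risingBinom_succ, ← mul_assoc, ih]
    push_cast
    ring

lemma ringChoose_eq_risingBinom (x : ℂ) (k : ℕ) :
    Ring.choose (x + k) k = risingBinom x k := by
  have h : ∀ k : ℕ, (k.factorial : ℂ) * risingBinom x k = (ascPochhammer ℂ k).eval (x + 1) := by
    intro k
    induction k with
    | zero => simp [risingBinom_zero]
    | succ k ih =>
      rw [ascPochhammer_succ_eval, ← ih, Nat.factorial_succ]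
      have := succ_mul_risingBinom_succ x k
      push_cast
      linear_combination (k.factorial : ℂ) * this
  have h1 := Ring.descPochhammer_eq_factorial_smul_choose (x + (k : ℂ)) k
  rw [Polynomial.descPochhammer_smeval_eq_ascPochhammer, nsmul_eq_mul,
    Polynomial.ascPochhammer_smeval_eq_eval] at h1
  have h2 : x + (k : ℂ) - k + 1 = x + 1 := by ring
  rw [h2, ← h] at h1
  exact (mul_left_cancel₀ (by exact_mod_cast k.factorial_ne_zero) h1).symm

/-! ### Weighted moments and contiguity of the weights in `(m, N)` -/

/-- The weighted moments `∑_{k=0}^N binom (m + N - k) m * binom (x + k) k * k ^ j * f k`. -/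
noncomputable def moment (x : ℂ) (m N j : ℕ) (f : ℕ → ℂ) : ℂ :=
  ∑ k ∈ Finset.range (N + 1),
    ((m + N - k).choose m : ℂ) * risingBinom x k * (k : ℂ) ^ j * f k

lemma choose_lower_top {m N k : ℕ} (hk : k ≤ N) :
    ((m : ℂ) + N - k) * ((m + N - (k + 1)).choose m : ℂ)
      = ((N : ℂ) - k) * ((m + N - k).choose m : ℂ) := by
  obtain ⟨d, rfl⟩ := Nat.exists_eq_add_of_le hk
  rcases d with _ | d
  · rcases m with _ | m
    -- For `m = 0` truncated subtraction makes the binomial `choose 0 0 = 1`, but the factor `m + N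
    -- - k` is zero.
    · simp
    · have : m + 1 + (k + 0) - (k + 1) = m := by omega
      rw [this, Nat.choose_succ_self]
      simp
  · have h1 : m + (k + (d + 1)) - (k + 1) = m + d := by omega
    have h2 : m + (k + (d + 1)) - k = m + d + 1 := by omega
    rw [h1, h2]
    have h := Nat.choose_mul_succ_eq (m + d) m
    have h3 : m + d + 1 - m = d + 1 := by omega
    rw [h3] at h
    have h' : ((m + d).choose m : ℂ) * (m + d + 1) = ((m + d + 1).choose m : ℂ) * (d + 1) := by
      exact_mod_cast h
    push_cast
    linear_combination h'

lemma choose_raise_bottom {m N k : ℕ} (hk : k ≤ N) :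
    ((m : ℂ) + 1) * ((m + 1 + N - k).choose (m + 1) : ℂ)
      = ((m : ℂ) + N + 1 - k) * ((m + N - k).choose m : ℂ) := by
  obtain ⟨d, rfl⟩ := Nat.exists_eq_add_of_le hk
  have h1 : m + 1 + (k + d) - k = m + d + 1 := by omega
  have h2 : m + (k + d) - k = m + d := by omega
  rw [h1, h2]
  have h := Nat.add_one_mul_choose_eq (m + d) m
  have h' : ((m : ℂ) + d + 1) * ((m + d).choose m : ℂ)
      = ((m + d + 1).choose (m + 1) : ℂ) * (m + 1) := by exact_mod_cast h
  push_cast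
  linear_combination -h'

lemma choose_raise_bottom_lower_top {m N k : ℕ} (hk : k ≤ N + 1) :
    ((m : ℂ) + 1) * ((m + 1 + N - k).choose (m + 1) : ℂ)
      = ((N : ℂ) + 1 - k) * ((m + (N + 1) - k).choose m : ℂ) := by
  obtain ⟨d, hd⟩ := Nat.exists_eq_add_of_le hk
  have h1 : m + 1 + N - k = m + d := by omega
  have h2 : m + (N + 1) - k = m + d := by omega
  have h3 : (N : ℂ) + 1 = k + d := by exact_mod_cast hd
  rw [h1, h2, h3]
  have h := Nat.choose_succ_right_eq (m + d) m
  rw [Nat.add_sub_cancel_left] at h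
  have h' : ((m + d).choose (m + 1) : ℂ) * (m + 1) = ((m + d).choose m : ℂ) * d := by
    exact_mod_cast h
  linear_combination h'

lemma moment_raise (x : ℂ) (m N j : ℕ) (f : ℕ → ℂ) :
    ((m : ℂ) + 1) * moment x (m + 1) N j f
      = ((m : ℂ) + N + 1) * moment x m N j f - moment x m N (j + 1) f := by
  simp only [moment, Finset.mul_sum, ← Finset.sum_sub_distrib]
  refine Finset.sum_congr rfl fun k hk => ?_
  have h := choose_raise_bottom (m := m) (Finset.mem_range_succ_iff.1 hk)
  linear_combination risingBinom x k * (k : ℂ) ^ j * f k * h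

lemma moment_raise_lower (x : ℂ) (m N j : ℕ) (f : ℕ → ℂ) :
    ((m : ℂ) + 1) * moment x (m + 1) N j f
      = ((N : ℂ) + 1) * moment x m (N + 1) j f - moment x m (N + 1) (j + 1) f := by
  -- The extra term `k = N + 1` has weight `choose m (m + 1) = 0`, so both sides can range over the
  -- same `k`.
  have h0 : moment x (m + 1) N j f = ∑ k ∈ Finset.range (N + 1 + 1),
      ((m + 1 + N - k).choose (m + 1) : ℂ) * risingBinom x k * (k : ℂ) ^ j * f k := by
    have : m + 1 + N - (N + 1) = m := by omega
    rw [Finset.sum_range_succ, this, Nat.choose_succ_self]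
    simp [moment]
  rw [h0]
  simp only [moment, Finset.mul_sum, ← Finset.sum_sub_distrib]
  refine Finset.sum_congr rfl fun k hk => ?_
  have h := choose_raise_bottom_lower_top (m := m) (Finset.mem_range_succ_iff.1 hk)
  linear_combination risingBinom x k * (k : ℂ) ^ j * f k * h

/-! ### Linear relations among moments from telescoping -/

/-- Abel summation against the weights of `moment`. -/
lemma sum_telescope (x : ℂ) (m N : ℕ) (g : ℕ → ℂ) :
    ∑ k ∈ Finset.range (N + 1), ((m + N - k).choose m : ℂ) * risingBinom x k *
      (((N : ℂ) - k) * (x + k + 1) * g (k + 1) - k * ((m : ℂ) + N + 1 - k) * g k) = 0 := by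
  have h := Finset.sum_range_sub (fun k : ℕ => ((m + N - k).choose m : ℂ) * risingBinom x k *
    (k * ((m : ℂ) + N + 1 - k) * g k)) (N + 1)
  -- Upper boundary term: the binomial vanishes for `m ≥ 1`, the linear factor for `m = 0`.
  have h1 : ((m : ℂ) + N + 1 - ((N + 1 : ℕ) : ℂ)) * ((m + N - (N + 1)).choose m : ℂ) = 0 := by
    have := choose_lower_top (m := m) (le_refl N)
    push_cast
    linear_combination this
  have h2 : ((m + N - (N + 1)).choose m : ℂ) * risingBinom x (N + 1) *
      (((N + 1 : ℕ) : ℂ) * ((m : ℂ) + N + 1 - ((N + 1 : ℕ) : ℂ)) * g (N + 1)) = 0 := by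
    linear_combination risingBinom x (N + 1) * ((N + 1 : ℕ) : ℂ) * g (N + 1) * h1
  simp only [h2, Nat.cast_zero, zero_mul, mul_zero, sub_zero] at h
  rw [← h]
  refine Finset.sum_congr rfl fun k hk => ?_
  have h3 := choose_lower_top (m := m) (Finset.mem_range_succ_iff.1 hk)
  have h4 := succ_mul_risingBinom_succ x k
  push_cast
  linear_combination -(x + k + 1) * risingBinom x k * g (k + 1) * h3
    - ((m + N - (k + 1)).choose m : ℂ) * ((m : ℂ) + N - k) * g (k + 1) * h4

section Relations

variable {x : ℂ} {m N : ℕ} {f e : ℕ → ℂ}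

/-- Telescoping with `g = f`. The `k²` terms of `(N-k)(x+k+1) - k(m+N+1-k)` cancel, so moment 1 is
determined by moment 0 and the moments of `e`. -/
lemma moment_relation_first
    (h : ∀ k < N, (x + k + 1) * f (k + 1) = (x + k + 1) * f k + e k) :
    (N : ℂ) * (x + 1) * moment x m N 0 f - (x + m + 2) * moment x m N 1 f
      = moment x m N 1 e - N * moment x m N 0 e := by
  rw [← sub_eq_zero, ← sum_telescope x m N f]
  simp only [moment, Finset.mul_sum, ← Finset.sum_sub_distrib]
  refine Finset.sum_congr rfl fun k hk => ?_
  -- At `k = N` the factor `N - k` vanishes, so the difference equation is needed only for `k < N`.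
  rcases (Finset.mem_range_succ_iff.1 hk).lt_or_eq with hk | rfl
  · linear_combination -((m + N - k).choose m : ℂ) * risingBinom x k * ((N : ℂ) - k) * h k hk
  · ring

lemma moment_relation_first'
    (h : ∀ k < N, (x + k + 1) * f (k + 1) = (x + k + 1) * f k + e k) :
    (N : ℂ) * (x + 1) * moment x m N 0 f + (N * (x + 2) - (x + 1)) * moment x m N 1 f
        - (x + m + 3) * moment x m N 2 f
      = moment x m N 2 e - (N - 1) * moment x m N 1 e - N * moment x m N 0 e := by
  rw [← sub_eq_zero, ← sum_telescope x m N (fun k => k * f k)]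
  simp only [moment, Finset.mul_sum, ← Finset.sum_sub_distrib, ← Finset.sum_add_distrib]
  refine Finset.sum_congr rfl fun k hk => ?_
  push_cast
  rcases (Finset.mem_range_succ_iff.1 hk).lt_or_eq with hk | rfl
  · linear_combination
      -((m + N - k).choose m : ℂ) * risingBinom x k * ((N : ℂ) - k) * (k + 1) * h k hk
  · ring

/-- Telescoping with `g k = (x + k) f k` supplies the second factor `x + k + 1` that the difference
equation requires. The cubic terms cancel, but moments 0, 1 and 2 remain, leaving two free. -/
lemma moment_relation_second
    (h : ∀ k < N, (x + k + 1) ^ 2 * f (k + 1) = (x + k + 1) ^ 2 * f k + e k) :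
    (N : ℂ) * (x + 1) ^ 2 * moment x m N 0 f
        + (2 * N * (x + 1) - (x + 1) ^ 2 - x * (m + N + 1)) * moment x m N 1 f
        - (x + m + 3) * moment x m N 2 f
      = moment x m N 1 e - N * moment x m N 0 e := by
  rw [← sub_eq_zero, ← sum_telescope x m N (fun k => (x + k) * f k)]
  simp only [moment, Finset.mul_sum, ← Finset.sum_sub_distrib, ← Finset.sum_add_distrib]
  refine Finset.sum_congr rfl fun k hk => ?_
  push_cast
  rcases (Finset.mem_range_succ_iff.1 hk).lt_or_eq with hk | rfl
  · linear_combination -((m + N - k).choose m : ℂ) * risingBinom x k * ((N : ℂ) - k) * h k hk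
  · ring

lemma moment_relation_second'
    (h : ∀ k < N, (x + k + 1) ^ 2 * f (k + 1) = (x + k + 1) ^ 2 * f k + e k) :
    (N : ℂ) * (x + 1) ^ 2 * moment x m N 0 f
        + (N * (x + 1) ^ 2 + 2 * N * (x + 1) - (x + 1) ^ 2) * moment x m N 1 f
        + (2 * N * (x + 1) + N - (x + 1) ^ 2 - 2 * (x + 1) - x * (m + N + 1)) * moment x m N 2 f
        - (x + m + 4) * moment x m N 3 f
      = moment x m N 2 e - (N - 1) * moment x m N 1 e - N * moment x m N 0 e := by
  rw [← sub_eq_zero, ← sum_telescope x m N (fun k => k * (x + k) * f k)]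
  simp only [moment, Finset.mul_sum, ← Finset.sum_sub_distrib, ← Finset.sum_add_distrib]
  refine Finset.sum_congr rfl fun k hk => ?_
  push_cast
  rcases (Finset.mem_range_succ_iff.1 hk).lt_or_eq with hk | rfl
  · linear_combination
      -((m + N - k).choose m : ℂ) * risingBinom x k * ((N : ℂ) - k) * (k + 1) * h k hk
  · ring

end Relations

/-! ### Recurrences along the diagonal `m = N` -/

section Steps

variable {x : ℂ} {m : ℕ} {f e : ℕ → ℂ}

/-- Level `(m, m+2)` links consecutive diagonal levels: `moment_raise_lower` leads from it to `(m+1,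
m+1)`, and raising `m` twice leads to `(m+2, m+2)`. The telescoping relations at `(m, m+2)`
eliminate its moments. -/
lemma moment_step_first
    (h : ∀ k < m + 2, (x + k + 1) * f (k + 1) = (x + k + 1) * f k + e k) :
    (x + m + 3) * ((m : ℂ) + 2) * moment x (m + 2) (m + 2) 0 f
      = (x + 2 * m + 4) * (x + 2 * m + 5) * moment x (m + 1) (m + 1) 0 f
        + (x + 2) * moment x (m + 1) (m + 1) 0 e + moment x (m + 1) (m + 1) 1 e := by
  have hm : (m : ℂ) + 1 ≠ 0 := Nat.cast_add_one_ne_zero m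
  have h1 := moment_relation_first (m := m) h
  have h2 := moment_relation_first' (m := m) h
  have hl := moment_raise_lower x m (m + 1) 0 f
  have he0 := moment_raise_lower x m (m + 1) 0 e
  have he1 := moment_raise_lower x m (m + 1) 1 e
  have r1 := moment_raise x m (m + 2) 0 f
  have r2 := moment_raise x m (m + 2) 1 f
  have r3 := moment_raise x (m + 1) (m + 2) 0 f
  simp only [zero_add, add_assoc, one_add_one_eq_two] at h1 h2 hl he0 he1 r1 r2 r3 ⊢
  push_cast at h1 h2 hl he0 he1 r1 r2 r3 ⊢
  generalize moment x m (m + 2) 0 f = a at *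
  generalize moment x m (m + 2) 1 f = b at *
  generalize moment x m (m + 2) 2 f = c at *
  generalize moment x m (m + 2) 0 e = p at *
  generalize moment x m (m + 2) 1 e = q at *
  generalize moment x m (m + 2) 2 e = r at *
  generalize moment x (m + 1) (m + 1) 0 f = s at *
  generalize moment x (m + 1) (m + 1) 0 e = s0 at *
  generalize moment x (m + 1) (m + 1) 1 e = s1 at *
  -- Eliminating `b` between `h1` and `hl` leaves the zeroth moment at level `(m, m+2)` in diagonal
  -- data alone.
  have ha : ((m : ℂ) + 1) * ((m + 2) * a) = (m + 1) * ((x + m + 2) * s + s0) := by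
    linear_combination -h1 - (x + m + 2) * hl - he0
  apply mul_left_cancel₀ hm
  linear_combination ((m : ℂ) + 1) * (x + m + 3) * r3 + (x + m + 3) * (2 * m + 4) * r1
    - (x + m + 3) * r2 - h2 - he1 - he0 + (x + 1) * ha
    + (-(4 * m + 7) * (x + m + 3) + (m + 1) * (x + 2) + 1) * hl

/-- Here `a`, `b`, `c`, `d` are the moments of orders 0 to 3 at the intermediate level `(m, m+2)`.
They are left unsolved so that no denominators appear before the closed forms are substituted. -/
lemma moment_step_second
    (h : ∀ k < m + 2, (x + k + 1) ^ 2 * f (k + 1) = (x + k + 1) ^ 2 * f k + e k) :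
    ∃ a b c d : ℂ,
      ((m : ℂ) + 2) * (x + m + 2) * a = moment x (m + 1) (m + 1) 0 e
        + ((x + m + 3) * (m + 2) - (2 * m + 3 - x ^ 2 - x)) * moment x (m + 1) (m + 1) 0 f
        + (x + m + 3) * moment x (m + 1) (m + 1) 1 f
      ∧ b = ((m : ℂ) + 2) * a - (m + 1) * moment x (m + 1) (m + 1) 0 f
      ∧ c = ((m : ℂ) + 2) * b - (m + 1) * moment x (m + 1) (m + 1) 1 f
      ∧ (x + m + 4) * d = ((m : ℂ) + 2) * (x + 1) ^ 2 * a
        + ((m + 1) * (x + 1) ^ 2 + 2 * (m + 2) * (x + 1)) * b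
        + (3 * (m : ℂ) + 3 - x ^ 2 - 3 * x) * c
        + (m + 1) * (moment x (m + 1) (m + 1) 0 e + moment x (m + 1) (m + 1) 1 e)
      ∧ ((m : ℂ) + 1) * (m + 2) * moment x (m + 2) (m + 2) 0 f
        = (2 * m + 3) * (2 * m + 4) * a - (4 * m + 7) * b + c
      ∧ ((m : ℂ) + 1) * (m + 2) * moment x (m + 2) (m + 2) 1 f
        = (2 * m + 3) * (2 * m + 4) * b - (4 * m + 7) * c + d := by
  have hm : (m : ℂ) + 1 ≠ 0 := Nat.cast_add_one_ne_zero m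
  have h1 := moment_relation_second (m := m) h
  have h2 := moment_relation_second' (m := m) h
  have hl0 := moment_raise_lower x m (m + 1) 0 f
  have hl1 := moment_raise_lower x m (m + 1) 1 f
  have he0 := moment_raise_lower x m (m + 1) 0 e
  have he1 := moment_raise_lower x m (m + 1) 1 e
  have r0 := moment_raise x m (m + 2) 0 f
  have r1 := moment_raise x m (m + 2) 1 f
  have r2 := moment_raise x m (m + 2) 2 f
  have r3 := moment_raise x (m + 1) (m + 2) 0 f
  have r4 := moment_raise x (m + 1) (m + 2) 1 f
  simp only [Nat.reduceAdd, zero_add, add_assoc, one_add_one_eq_two]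
    at h1 h2 hl0 hl1 he0 he1 r0 r1 r2 r3 r4
  push_cast at h1 h2 hl0 hl1 he0 he1 r0 r1 r2 r3 r4
  refine ⟨moment x m (m + 2) 0 f, moment x m (m + 2) 1 f, moment x m (m + 2) 2 f,
    moment x m (m + 2) 3 f, ?_, ?_, ?_, ?_, ?_, ?_⟩
  · apply mul_left_cancel₀ hm
    linear_combination -h1 - he0 - (x + m + 3) * hl1
      + (2 * m + 3 - x ^ 2 - x - (x + m + 3) * (m + 2)) * hl0
  · linear_combination hl0
  · linear_combination hl1
  · linear_combination -h2 - he0 - he1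
  · linear_combination (m + 1) * r3 + (2 * m + 4) * r0 - r1
  · linear_combination (m + 1) * r4 + (2 * m + 4) * r1 - r2

end Steps

/-! ### Harmonic numbers, the central binomial and their difference equations -/

lemma genHarmonicOrd_succ (l k : ℕ) (x : ℂ) :
    genHarmonicOrd l (k + 1) x = genHarmonicOrd l k x + 1 / (x + k + 1) ^ l := by
  simp only [genHarmonicOrd, Finset.sum_Icc_succ_top (Nat.le_add_left 1 k)]
  push_cast
  ring

lemma genHarmonic_succ (k : ℕ) (x : ℂ) :
    genHarmonic (k + 1) x = genHarmonic k x + 1 / (x + k + 1) := by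
  simp [genHarmonic, genHarmonicOrd_succ]

lemma genHarmonicOrd_zero (l : ℕ) (x : ℂ) : genHarmonicOrd l 0 x = 0 := by
  simp [genHarmonicOrd]

lemma genHarmonic_zero (x : ℂ) : genHarmonic 0 x = 0 := genHarmonicOrd_zero 1 x

/-- The value `binom (x + 2 n + 1) n` of the unweighted convolution. -/
noncomputable def centralBinom (x : ℂ) (n : ℕ) : ℂ := risingBinom (x + n + 1) n

/-- This is the homogeneous part of `moment_step_first`, shifted by `n = m + 1`. -/
lemma centralBinom_succ (x : ℂ) (n : ℕ) :
    ((n : ℂ) + 1) * (x + n + 2) * centralBinom x (n + 1)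
      = (x + 2 * n + 2) * (x + 2 * n + 3) * centralBinom x n := by
  have h1 := risingBinom_shift (x + n + 1) (n + 1)
  have h2 := succ_mul_risingBinom_succ (x + n + 1) n
  have h3 : centralBinom x (n + 1) = risingBinom (x + n + 1 + 1) (n + 1) := by
    rw [centralBinom]
    push_cast
    ring_nf
  rw [h3, centralBinom]
  push_cast at h1
  linear_combination ((n : ℂ) + 1) * h1 + (x + 2 * n + 3) * h2

lemma centralBinom_succ_eq {x : ℂ} {m : ℕ} (h : x + m + 3 ≠ 0) :
    centralBinom x (m + 1 + 1)
      = (x + 2 * m + 4) * (x + 2 * m + 5) * centralBinom x (m + 1) / ((m + 2) * (x + m + 3)) := by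
  have h3 : (m : ℂ) + 2 ≠ 0 := by exact_mod_cast (by omega : m + 2 ≠ 0)
  have hc := centralBinom_succ x (m + 1)
  rw [eq_div_iff (mul_ne_zero h3 h)]
  push_cast at hc
  linear_combination hc

/-- The alternating harmonic sum `∑_{k=1}^{2n+1} 2 (-1)^k / (x + k)`. -/
noncomputable def altHarmonic (n : ℕ) (x : ℂ) : ℂ :=
  genHarmonic n (x / 2) - genHarmonic (n + 1) ((x - 1) / 2)

lemma altHarmonic_succ (n : ℕ) (x : ℂ) :
    altHarmonic (n + 1) x = altHarmonic n x + 2 / (x + 2 * n + 2) - 2 / (x + 2 * n + 3) := by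
  have h1 : x / 2 + n + 1 = (x + 2 * n + 2) / 2 := by ring
  have h2 : (x - 1) / 2 + ((n + 1 : ℕ) : ℂ) + 1 = (x + 2 * n + 3) / 2 := by push_cast; ring
  rw [altHarmonic, altHarmonic, genHarmonic_succ, genHarmonic_succ (n + 1), h1, h2, one_div_div,
    one_div_div]
  ring

lemma altHarmonic_zero (x : ℂ) : altHarmonic 0 x = -2 / (x + 1) := by
  have h : (x - 1) / 2 + ((0 : ℕ) : ℂ) + 1 = (x + 1) / 2 := by push_cast; ring
  rw [altHarmonic, genHarmonic_succ, genHarmonic_zero, genHarmonic_zero, h, one_div_div]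
  ring

section Differences

variable {x : ℂ} {k : ℕ}

lemma mul_genHarmonic_succ (h : x + k + 1 ≠ 0) :
    (x + k + 1) * genHarmonic (k + 1) x = (x + k + 1) * genHarmonic k x + 1 := by
  rw [genHarmonic_succ]
  field_simp

lemma mul_genHarmonicOrd_two_succ (h : x + k + 1 ≠ 0) :
    (x + k + 1) ^ 2 * genHarmonicOrd 2 (k + 1) x
      = (x + k + 1) ^ 2 * genHarmonicOrd 2 k x + 1 := by
  rw [genHarmonicOrd_succ]
  field_simp

lemma mul_genHarmonic_sq_sub_succ (h : x + k + 1 ≠ 0) :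
    (x + k + 1) * (genHarmonic (k + 1) x ^ 2 - genHarmonicOrd 2 (k + 1) x)
      = (x + k + 1) * (genHarmonic k x ^ 2 - genHarmonicOrd 2 k x) + 2 * genHarmonic k x := by
  rw [genHarmonic_succ, genHarmonicOrd_succ]
  field_simp
  ring

end Differences

lemma moment_const_mul (x c : ℂ) (m N j : ℕ) (f : ℕ → ℂ) :
    moment x m N j (fun k => c * f k) = c * moment x m N j f := by
  simp only [moment, Finset.mul_sum]
  exact Finset.sum_congr rfl fun k _ => by ring

lemma moment_zero_fun (x : ℂ) (m N j : ℕ) : moment x m N j (fun _ => 0) = 0 := by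
  simp [moment]

lemma moment_one_one_zero (x : ℂ) (f : ℕ → ℂ) :
    moment x 1 1 0 f = 2 * f 0 + (x + 1) * f 1 := by
  simp [moment, Finset.sum_range_succ, risingBinom]

lemma moment_one_one_one (x : ℂ) (f : ℕ → ℂ) : moment x 1 1 1 f = (x + 1) * f 1 := by
  simp [moment, Finset.sum_range_succ, risingBinom]

lemma centralBinom_one (x : ℂ) : centralBinom x 1 = x + 3 := by
  simp [centralBinom, risingBinom]
  ring

lemma ne_zero_of_avoid {x : ℂ} {M : ℕ} (hx : ∀ j ∈ Finset.Icc 1 M, x ≠ -(j : ℂ)) {j : ℕ}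
    (h1 : 1 ≤ j) (h2 : j ≤ M) : x + j ≠ 0 := fun h =>
  hx j (Finset.mem_Icc.2 ⟨h1, h2⟩) (eq_neg_of_add_eq_zero_left h)

/-! ### Closed forms for the moments of `1` and `H_k` -/

section ClosedForms

variable {x : ℂ} {n : ℕ}

lemma avoid_mono {M M' : ℕ} (hM : M' ≤ M) (hx : ∀ j ∈ Finset.Icc 1 M, x ≠ -(j : ℂ)) :
    ∀ j ∈ Finset.Icc 1 M', x ≠ -(j : ℂ) :=
  fun j hj => hx j (Finset.Icc_subset_Icc_right hM hj)

lemma ne_zero_of_avoid_succ {M k : ℕ} (hx : ∀ j ∈ Finset.Icc 1 M, x ≠ -(j : ℂ)) (hk : k < M) :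
    x + k + 1 ≠ 0 := by
  have := ne_zero_of_avoid hx (Nat.le_add_left 1 k) hk
  push_cast at this
  rwa [← add_assoc] at this

lemma moment_zero_one (hn : 1 ≤ n) (hx : ∀ j ∈ Finset.Icc 1 (2 * n + 1), x ≠ -(j : ℂ)) :
    moment x n n 0 (fun _ => 1) = centralBinom x n := by
  induction n, hn using Nat.le_induction with
  | base => rw [moment_one_one_zero, centralBinom_one]; ring
  | succ n hn ih =>
    obtain ⟨m, rfl⟩ := Nat.exists_eq_add_of_le' hn
    have h2 : x + m + 3 ≠ 0 := by
      have := ne_zero_of_avoid_succ (k := m + 2) hx (by omega)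
      push_cast at this
      ring_nf at this ⊢; exact this
    have h3 : (m : ℂ) + 2 ≠ 0 := by exact_mod_cast (by omega : m + 2 ≠ 0)
    have hs := moment_step_first (x := x) (m := m) (f := fun _ => 1) (e := fun _ => 0)
      (fun k _ => by ring)
    have hc := centralBinom_succ x (m + 1)
    rw [moment_zero_fun, moment_zero_fun, ih (avoid_mono (by omega) hx)] at hs
    push_cast at hc
    apply mul_left_cancel₀ (mul_ne_zero h2 h3)
    linear_combination hs - hc

lemma moment_one_eq {f e : ℕ → ℂ} (hx : x + n + 2 ≠ 0)
    (h : ∀ k < n, (x + k + 1) * f (k + 1) = (x + k + 1) * f k + e k) :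
    moment x n n 1 f = (n * (x + 1) * moment x n n 0 f - moment x n n 1 e
      + n * moment x n n 0 e) / (x + n + 2) := by
  rw [eq_div_iff hx]
  linear_combination -moment_relation_first (m := n) h

lemma moment_two_eq {f e : ℕ → ℂ} (hx : x + n + 3 ≠ 0)
    (h : ∀ k < n, (x + k + 1) * f (k + 1) = (x + k + 1) * f k + e k) :
    moment x n n 2 f = (n * (x + 1) * moment x n n 0 f
      + (n * (x + 2) - (x + 1)) * moment x n n 1 f - moment x n n 2 e
      + (n - 1) * moment x n n 1 e + n * moment x n n 0 e) / (x + n + 3) := by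
  rw [eq_div_iff hx]
  linear_combination -moment_relation_first' (m := n) h

lemma moment_two_eq_of_second {f e : ℕ → ℂ} (hx : x + n + 3 ≠ 0)
    (h : ∀ k < n, (x + k + 1) ^ 2 * f (k + 1) = (x + k + 1) ^ 2 * f k + e k) :
    moment x n n 2 f = (n * (x + 1) ^ 2 * moment x n n 0 f
      + (2 * n - x ^ 2 - 3 * x - 1) * moment x n n 1 f - moment x n n 1 e
      + n * moment x n n 0 e) / (x + n + 3) := by
  rw [eq_div_iff hx]
  linear_combination -moment_relation_second (m := n) h

lemma moment_one_one (hn : 1 ≤ n) (hx : ∀ j ∈ Finset.Icc 1 (2 * n + 1), x ≠ -(j : ℂ)) :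
    moment x n n 1 (fun _ => 1) = n * (x + 1) * centralBinom x n / (x + n + 2) := by
  have h2 : x + n + 2 ≠ 0 := by
    have := ne_zero_of_avoid_succ (k := n + 1) hx (by omega)
    push_cast at this
    ring_nf at this ⊢; exact this
  rw [moment_one_eq (e := fun _ => 0) h2 (fun k _ => by ring), moment_zero_one hn hx,
    moment_zero_fun, moment_zero_fun]
  ring

/-- Formally the `x`-derivative of `moment_zero_one`: `H_{2n+1} - H_{n+1}` is the logarithmic
derivative of `binom (x+2n+1) n`. -/
lemma moment_zero_genHarmonic (hn : 1 ≤ n)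
    (hx : ∀ j ∈ Finset.Icc 1 (2 * n + 1), x ≠ -(j : ℂ)) :
    moment x n n 0 (fun k => genHarmonic k x)
      = centralBinom x n * (genHarmonic (2 * n + 1) x - genHarmonic (n + 1) x) := by
  induction n, hn using Nat.le_induction with
  | base =>
    have h0 : x + 1 ≠ 0 := by simpa using ne_zero_of_avoid_succ (k := 0) hx (by omega)
    have h3 : x + 3 ≠ 0 := by simpa using ne_zero_of_avoid (j := 3) hx (by omega) (by omega)
    rw [moment_one_one_zero, centralBinom_one, genHarmonic_succ (2 * 1), genHarmonic_zero,
      genHarmonic_succ 0, genHarmonic_zero]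
    norm_num
    rw [add_assoc x 2 1]
    norm_num
    field_simp
  | succ n hn ih =>
    obtain ⟨m, rfl⟩ := Nat.exists_eq_add_of_le' hn
    have hx' := avoid_mono (M' := 2 * (m + 1) + 1) (by omega) hx
    have h2 : x + m + 3 ≠ 0 := by
      have := ne_zero_of_avoid_succ (k := m + 2) hx (by omega)
      push_cast at this
      ring_nf at this ⊢; exact this
    have h4 : x + 2 * m + 4 ≠ 0 := by
      have := ne_zero_of_avoid_succ (k := 2 * m + 3) hx (by omega)
      push_cast at this
      ring_nf at this ⊢; exact this
    have h5 : x + 2 * m + 5 ≠ 0 := by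
      have := ne_zero_of_avoid_succ (k := 2 * m + 4) hx (by omega)
      push_cast at this
      ring_nf at this ⊢; exact this
    have h3 : (m : ℂ) + 2 ≠ 0 := by exact_mod_cast (by omega : m + 2 ≠ 0)
    have hs := moment_step_first (x := x) (m := m) (f := fun k => genHarmonic k x)
      (e := fun _ => 1)
      (fun k hk => mul_genHarmonic_succ (ne_zero_of_avoid_succ hx (by omega)))
    rw [moment_zero_one hn hx', moment_one_one hn hx', ih hx'] at hs
    have e1 : 2 * (m + 1 + 1) + 1 = 2 * (m + 1) + 1 + 1 + 1 := by ring
    have e2 : x + ((2 * (m + 1) + 1 : ℕ) : ℂ) + 1 = x + 2 * m + 4 := by push_cast; ring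
    have e3 : x + ((2 * (m + 1) + 1 + 1 : ℕ) : ℂ) + 1 = x + 2 * m + 5 := by push_cast; ring
    have e4 : x + ((m + 1 + 1 : ℕ) : ℂ) + 1 = x + m + 3 := by push_cast; ring
    rw [e1, genHarmonic_succ (2 * (m + 1) + 1 + 1), genHarmonic_succ (2 * (m + 1) + 1),
      genHarmonic_succ (m + 1 + 1), e2, e3, e4]
    apply mul_left_cancel₀ (mul_ne_zero h2 h3)
    have e5 : x + ((m + 1 : ℕ) : ℂ) + 2 = x + m + 3 := by push_cast; ring
    rw [hs, centralBinom_succ_eq h2, e5]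
    push_cast
    generalize genHarmonic (2 * (m + 1) + 1) x = A
    generalize genHarmonic (m + 1 + 1) x = B
    field_simp
    ring

end ClosedForms

/-! ### Closed forms for `H_k² - H_k^⟨2⟩` and `H_k^⟨2⟩` -/

section SecondOrder

variable {x : ℂ} {n : ℕ}

lemma moment_one_genHarmonic (hn : 1 ≤ n)
    (hx : ∀ j ∈ Finset.Icc 1 (2 * n + 1), x ≠ -(j : ℂ)) :
    moment x n n 1 (fun k => genHarmonic k x)
      = (n * (x + 1) * (centralBinom x n * (genHarmonic (2 * n + 1) x - genHarmonic (n + 1) x))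
        - n * (x + 1) * centralBinom x n / (x + n + 2) + n * centralBinom x n) / (x + n + 2) := by
  have h2 : x + n + 2 ≠ 0 := by
    have := ne_zero_of_avoid_succ (k := n + 1) hx (by omega)
    push_cast at this
    ring_nf at this ⊢; exact this
  rw [moment_one_eq (e := fun _ => 1) h2
    (fun k hk => mul_genHarmonic_succ (ne_zero_of_avoid_succ hx (by omega))),
    moment_zero_genHarmonic hn hx, moment_zero_one hn hx, moment_one_one hn hx]

lemma moment_zero_genHarmonic_sq_sub (hn : 1 ≤ n)
    (hx : ∀ j ∈ Finset.Icc 1 (2 * n + 1), x ≠ -(j : ℂ)) :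
    moment x n n 0 (fun k => genHarmonic k x ^ 2 - genHarmonicOrd 2 k x)
      = centralBinom x n * ((genHarmonic (2 * n + 1) x - genHarmonic (n + 1) x) ^ 2
        - (genHarmonicOrd 2 (2 * n + 1) x - genHarmonicOrd 2 (n + 1) x)) := by
  induction n, hn using Nat.le_induction with
  | base =>
    rw [moment_one_one_zero, genHarmonic_succ (2 * 1), genHarmonicOrd_succ 2 (2 * 1),
      genHarmonic_succ 0, genHarmonicOrd_succ 2 0, genHarmonic_zero, genHarmonicOrd_zero]
    norm_num
  | succ n hn ih =>
    obtain ⟨m, rfl⟩ := Nat.exists_eq_add_of_le' hn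
    have hx' := avoid_mono (M' := 2 * (m + 1) + 1) (by omega) hx
    have h2 : x + m + 3 ≠ 0 := by
      have := ne_zero_of_avoid_succ (k := m + 2) hx (by omega)
      push_cast at this
      ring_nf at this ⊢; exact this
    have h4 : x + 2 * m + 4 ≠ 0 := by
      have := ne_zero_of_avoid_succ (k := 2 * m + 3) hx (by omega)
      push_cast at this
      ring_nf at this ⊢; exact this
    have h5 : x + 2 * m + 5 ≠ 0 := by
      have := ne_zero_of_avoid_succ (k := 2 * m + 4) hx (by omega)
      push_cast at this
      ring_nf at this ⊢; exact this
    have h3 : (m : ℂ) + 2 ≠ 0 := by exact_mod_cast (by omega : m + 2 ≠ 0)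
    have hs := moment_step_first (x := x) (m := m)
      (f := fun k => genHarmonic k x ^ 2 - genHarmonicOrd 2 k x)
      (e := fun k => 2 * genHarmonic k x)
      (fun k hk => mul_genHarmonic_sq_sub_succ (ne_zero_of_avoid_succ hx (by omega)))
    rw [moment_const_mul, moment_const_mul, moment_zero_genHarmonic hn hx',
      moment_one_genHarmonic hn hx', ih hx'] at hs
    have e1 : 2 * (m + 1 + 1) + 1 = 2 * (m + 1) + 1 + 1 + 1 := by ring
    have e2 : x + ((2 * (m + 1) + 1 : ℕ) : ℂ) + 1 = x + 2 * m + 4 := by push_cast; ring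
    have e3 : x + ((2 * (m + 1) + 1 + 1 : ℕ) : ℂ) + 1 = x + 2 * m + 5 := by push_cast; ring
    have e4 : x + ((m + 1 + 1 : ℕ) : ℂ) + 1 = x + m + 3 := by push_cast; ring
    have e5 : x + ((m + 1 : ℕ) : ℂ) + 2 = x + m + 3 := by push_cast; ring
    rw [e1, genHarmonic_succ (2 * (m + 1) + 1 + 1), genHarmonic_succ (2 * (m + 1) + 1),
      genHarmonic_succ (m + 1 + 1), genHarmonicOrd_succ 2 (2 * (m + 1) + 1 + 1),
      genHarmonicOrd_succ 2 (2 * (m + 1) + 1), genHarmonicOrd_succ 2 (m + 1 + 1), e2, e3, e4]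
    apply mul_left_cancel₀ (mul_ne_zero h2 h3)
    rw [hs, centralBinom_succ_eq h2, e5]
    push_cast
    generalize genHarmonic (2 * (m + 1) + 1) x = A
    generalize genHarmonic (m + 1 + 1) x = B
    generalize genHarmonicOrd 2 (2 * (m + 1) + 1) x = C
    generalize genHarmonicOrd 2 (m + 1 + 1) x = D
    field_simp
    ring

lemma moment_genHarmonicOrd_two (hn : 1 ≤ n)
    (hx : ∀ j ∈ Finset.Icc 1 (2 * n + 1), x ≠ -(j : ℂ)) :
    moment x n n 0 (fun k => genHarmonicOrd 2 k x)
      = centralBinom x n / 8 * (4 * genHarmonicOrd 2 (2 * n + 1) x - altHarmonic n x ^ 2) ∧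
    moment x n n 1 (fun k => genHarmonicOrd 2 k x)
      = centralBinom x n / (8 * (x + n + 2)) *
        (n * (x + 1) * (4 * genHarmonicOrd 2 (2 * n + 1) x - altHarmonic n x ^ 2)
          - 4 * (x + n + 1) * altHarmonic n x - 8) := by
  induction n, hn using Nat.le_induction with
  | base =>
    have h0 : x + 1 ≠ 0 := by simpa using ne_zero_of_avoid_succ (k := 0) hx (by omega)
    have h2 : x + 2 ≠ 0 := by simpa using ne_zero_of_avoid (j := 2) hx (by omega) (by omega)
    have h3 : x + 3 ≠ 0 := by simpa using ne_zero_of_avoid (j := 3) hx (by omega) (by omega)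
    rw [moment_one_one_zero, moment_one_one_one, altHarmonic_succ 0, altHarmonic_zero,
      genHarmonicOrd_succ 2 (2 * 1), genHarmonicOrd_succ 2 1, genHarmonicOrd_succ 2 0,
      genHarmonicOrd_zero, centralBinom_one]
    have e1 : x + 1 + 1 = x + 2 := by ring
    have e2 : x + 2 + 1 = x + 3 := by ring
    have e3 : x + 1 + 2 = x + 3 := by ring
    push_cast
    simp only [mul_zero, add_zero, zero_add, e1, e2, e3]
    constructor <;> field_simp <;> ring
  | succ n hn ih =>
    obtain ⟨m, rfl⟩ := Nat.exists_eq_add_of_le' hn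
    have hx' := avoid_mono (M' := 2 * (m + 1) + 1) (by omega) hx
    obtain ⟨ih0, ih1⟩ := ih hx'
    have h1 : x + m + 2 ≠ 0 := by
      have := ne_zero_of_avoid_succ (k := m + 1) hx (by omega)
      push_cast at this
      ring_nf at this ⊢; exact this
    have h2 : x + m + 3 ≠ 0 := by
      have := ne_zero_of_avoid_succ (k := m + 2) hx (by omega)
      push_cast at this
      ring_nf at this ⊢; exact this
    have h2' : x + m + 4 ≠ 0 := by
      have := ne_zero_of_avoid_succ (k := m + 3) hx (by omega)
      push_cast at this
      ring_nf at this ⊢; exact this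
    have h4 : x + 2 * m + 4 ≠ 0 := by
      have := ne_zero_of_avoid_succ (k := 2 * m + 3) hx (by omega)
      push_cast at this
      ring_nf at this ⊢; exact this
    have h5 : x + 2 * m + 5 ≠ 0 := by
      have := ne_zero_of_avoid_succ (k := 2 * m + 4) hx (by omega)
      push_cast at this
      ring_nf at this ⊢; exact this
    have h3 : (m : ℂ) + 2 ≠ 0 := by exact_mod_cast (by omega : m + 2 ≠ 0)
    have h6 : (m : ℂ) + 1 ≠ 0 := Nat.cast_add_one_ne_zero m
    obtain ⟨a, b, c, d, ha, hb, hc, hd, hT0, hT1⟩ := moment_step_second (x := x) (m := m)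
      (f := fun k => genHarmonicOrd 2 k x) (e := fun _ => 1)
      (fun k hk => mul_genHarmonicOrd_two_succ (ne_zero_of_avoid_succ hx (by omega)))
    rw [moment_zero_one hn hx', ih0, ih1] at ha
    rw [ih0] at hb
    rw [ih1] at hc
    rw [moment_zero_one hn hx', moment_one_one hn hx'] at hd
    have e1 : 2 * (m + 1 + 1) + 1 = 2 * (m + 1) + 1 + 1 + 1 := by ring
    have e2 : x + ((2 * (m + 1) + 1 : ℕ) : ℂ) + 1 = x + 2 * m + 4 := by push_cast; ring
    have e3 : x + ((2 * (m + 1) + 1 + 1 : ℕ) : ℂ) + 1 = x + 2 * m + 5 := by push_cast; ring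
    have e5 : x + ((m + 1 : ℕ) : ℂ) + 2 = x + m + 3 := by push_cast; ring
    have e6 : x + ((m + 1 + 1 : ℕ) : ℂ) + 2 = x + m + 4 := by push_cast; ring
    have e7 : x + 2 * ((m + 1 : ℕ) : ℂ) + 2 = x + 2 * m + 4 := by push_cast; ring
    have e8 : x + 2 * ((m + 1 : ℕ) : ℂ) + 3 = x + 2 * m + 5 := by push_cast; ring
    rw [e5] at ha hc hd
    rw [e1, altHarmonic_succ (m + 1), genHarmonicOrd_succ 2 (2 * (m + 1) + 1 + 1),
      genHarmonicOrd_succ 2 (2 * (m + 1) + 1), e2, e3, e6, e7, e8, centralBinom_succ_eq h2]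
    clear ih0 ih1 ih
    push_cast at ha hb hc hd ⊢
    generalize genHarmonicOrd 2 (2 * (m + 1) + 1) x = Q at *
    generalize altHarmonic (m + 1) x = B at *
    generalize centralBinom x (m + 1) = β at *
    -- The factor `x + m + 2` divides out, so `a` keeps only the denominator `m + 2` and `b` loses
    -- even that.
    have ha' : a = β / (8 * (m + 2)) * ((x + m + 2) * (4 * Q - B ^ 2) - 4 * B) := by
      apply mul_left_cancel₀ (mul_ne_zero h3 h1)
      rw [ha]
      field_simp
      ring
    have hb' : b = β / 8 * ((x + 1) * (4 * Q - B ^ 2) - 4 * B) := by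
      rw [hb, ha']
      field_simp
      ring
    rw [hb'] at hc
    constructor
    · apply mul_left_cancel₀ (mul_ne_zero h6 h3)
      rw [hT0, ha', hb', hc]
      field_simp
      ring
    · rw [ha', hb', hc] at hd
      have hd' : d = _ / (x + m + 4) := eq_div_of_mul_eq h2' ((mul_comm _ _).trans hd)
      apply mul_left_cancel₀ (mul_ne_zero h6 h3)
      rw [hT1, hd', hb', hc]
      field_simp
      ring

/-- Orders 2 and 1 reduce to order 0 by the telescoping relations; passing to `H_{n+3}` absorbs the
resulting `1/(x+n+2)` and `1/(x+n+3)`. The hypothesis `h3` is separate because `n + 3 ≤ 2n + 1`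
fails for `n = 1`. -/
lemma moment_two_genHarmonic_sq_sub (hn : 1 ≤ n)
    (hx : ∀ j ∈ Finset.Icc 1 (2 * n + 1), x ≠ -(j : ℂ)) (h3 : x + n + 3 ≠ 0) :
    moment x n n 2 (fun k => genHarmonic k x ^ 2 - genHarmonicOrd 2 k x)
      = n * centralBinom x n / ((x + n + 2) * (x + n + 3)) *
        ((x + 1) * (x * n + 3 * n + 1) *
            ((genHarmonic (n + 3) x - genHarmonic (2 * n + 1) x) ^ 2
              + (genHarmonicOrd 2 (n + 3) x - genHarmonicOrd 2 (2 * n + 1) x))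
          - 2 * (2 * x * n + 4 * n + 1) * (genHarmonic (n + 3) x - genHarmonic (2 * n + 1) x)
          + 2 * n) := by
  have h2 : x + n + 2 ≠ 0 := by
    have := ne_zero_of_avoid_succ (k := n + 1) hx (by omega)
    push_cast at this
    ring_nf at this ⊢; exact this
  have hne : ∀ k < n, x + k + 1 ≠ 0 := fun k hk => ne_zero_of_avoid_succ hx (by omega)
  rw [moment_two_eq (f := fun k => genHarmonic k x ^ 2 - genHarmonicOrd 2 k x)
      (e := fun k => 2 * genHarmonic k x) h3
      (fun k hk => mul_genHarmonic_sq_sub_succ (hne k hk)),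
    moment_one_eq (f := fun k => genHarmonic k x ^ 2 - genHarmonicOrd 2 k x)
      (e := fun k => 2 * genHarmonic k x) h2
      (fun k hk => mul_genHarmonic_sq_sub_succ (hne k hk)),
    moment_const_mul, moment_const_mul, moment_const_mul,
    moment_two_eq (f := fun k => genHarmonic k x) (e := fun _ => 1) h3
      (fun k hk => mul_genHarmonic_succ (hne k hk)),
    moment_two_eq (f := fun _ => 1) (e := fun _ => 0) h3 (fun k _ => by ring),
    moment_zero_fun, moment_zero_fun, moment_zero_fun,
    moment_one_genHarmonic hn hx, moment_zero_genHarmonic_sq_sub hn hx,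
    moment_zero_genHarmonic hn hx, moment_one_one hn hx, moment_zero_one hn hx]
  have e1 : x + ((n + 1 : ℕ) : ℂ) + 1 = x + n + 2 := by push_cast; ring
  have e2 : x + ((n + 1 + 1 : ℕ) : ℂ) + 1 = x + n + 3 := by push_cast; ring
  rw [genHarmonic_succ (n + 2), genHarmonic_succ (n + 1), genHarmonicOrd_succ 2 (n + 2),
    genHarmonicOrd_succ 2 (n + 1), e1, e2]
  generalize genHarmonic (2 * n + 1) x = A
  generalize genHarmonic (n + 1) x = C
  generalize genHarmonicOrd 2 (2 * n + 1) x = Q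
  generalize genHarmonicOrd 2 (n + 1) x = D
  generalize centralBinom x n = β
  clear hx hne
  field_simp
  ring

lemma moment_two_genHarmonicOrd_two (hn : 1 ≤ n)
    (hx : ∀ j ∈ Finset.Icc 1 (2 * n + 1), x ≠ -(j : ℂ)) (h3 : x + n + 3 ≠ 0) :
    moment x n n 2 (fun k => genHarmonicOrd 2 k x)
      = centralBinom x n / (8 * ((x + n + 2) * (x + n + 3))) *
        (n * ((x + 1) * (x * n + 3 * n + 1)) *
            (4 * genHarmonicOrd 2 (2 * n + 1) x - altHarmonic n x ^ 2)
          + 4 * (x + n + 1) * (x ^ 2 + 3 * x - 2 * n + 1) * altHarmonic n x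
          + 8 * (x ^ 2 + 3 * x + n ^ 2 - n + 1)) := by
  have h2 : x + n + 2 ≠ 0 := by
    have := ne_zero_of_avoid_succ (k := n + 1) hx (by omega)
    push_cast at this
    ring_nf at this ⊢; exact this
  rw [moment_two_eq_of_second (f := fun k => genHarmonicOrd 2 k x) (e := fun _ => 1) h3
      (fun k hk => mul_genHarmonicOrd_two_succ (ne_zero_of_avoid_succ hx (by omega))),
    (moment_genHarmonicOrd_two hn hx).1, (moment_genHarmonicOrd_two hn hx).2,
    moment_one_one hn hx, moment_zero_one hn hx]
  generalize genHarmonicOrd 2 (2 * n + 1) x = Q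
  generalize altHarmonic n x = B
  generalize centralBinom x n = β
  clear hx
  field_simp
  ring

end SecondOrder

/-! ### Assembly -/

lemma ringChoose_eq_centralBinom {x : ℂ} {n : ℕ} (h2 : x + n + 2 ≠ 0) (h3 : x + n + 3 ≠ 0)
    (hn : 2 ≤ n) :
    Ring.choose (x + 2 * (n : ℂ) + 1) (n - 2)
      = n * (n - 1) * centralBinom x n / ((x + n + 2) * (x + n + 3)) := by
  obtain ⟨m, rfl⟩ := Nat.exists_eq_add_of_le' hn
  have e1 : x + 2 * ((m + 2 : ℕ) : ℂ) + 1 = (x + m + 5) + (m : ℕ) := by push_cast; ring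
  have e2 : centralBinom x (m + 2) = risingBinom (x + m + 3) (m + 2) := by
    rw [centralBinom]
    push_cast
    ring_nf
  have h1 := succ_mul_risingBinom_succ (x + m + 3) (m + 1)
  have h4 := succ_mul_risingBinom_succ (x + m + 3) m
  have h5 := risingBinom_shift (x + m + 3) m
  have h6 := risingBinom_shift (x + m + 3 + 1) m
  have e3 : x + (m : ℂ) + 3 + 1 + 1 = x + m + 5 := by ring
  rw [e3] at h6
  rw [Nat.add_sub_cancel, e1, ringChoose_eq_risingBinom, e2, eq_div_iff (mul_ne_zero h2 h3)]
  push_cast at *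
  -- With the top fixed, lowering the bottom index by two (`h1`, `h4`) shifts the `risingBinom`
  -- argument up by two (`h5`, `h6`).
  linear_combination (x + m + 4) * h6 + (x + 2 * m + 5) * h5 - (x + 2 * m + 5) * h4 - (m + 1) * h1

theorem theorem9 (n : ℕ) (hn : 2 ≤ n) (x : ℂ)
    (hx : ∀ j ∈ Finset.Icc 1 (2 * n + 1), x ≠ -(j : ℂ))
    (hxn : x * n + 3 * n + 1 ≠ 0) :
    ∑ k ∈ Finset.range (n + 1),
        ((2 * n - k).choose n : ℂ) * Ring.choose (x + (k : ℂ)) k * (k : ℂ) ^ 2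
          * genHarmonic k x ^ 2 =
      (x + 1) * (x * n + 3 * n + 1) / (8 * ((n : ℂ) - 1))
        * Ring.choose (x + 2 * (n : ℂ) + 1) (n - 2)
        * (8 * (genHarmonic (n + 3) x - genHarmonic (2 * n + 1) x)
              * (genHarmonic (n + 3) x - genHarmonic (2 * n + 1) x
                  - 2 * (2 * x * n + 4 * n + 1) / ((x + 1) * (x * n + 3 * n + 1)))
            - (genHarmonic n (x / 2) - genHarmonic (n + 1) ((x - 1) / 2))
              * (genHarmonic n (x / 2) - genHarmonic (n + 1) ((x - 1) / 2)
                  - 4 * (x + n + 1) * (x ^ 2 + 3 * x - 2 * n + 1)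
                    / (n * (x + 1) * (x * n + 3 * n + 1)))
            + 8 * genHarmonicOrd 2 (n + 3) x - 4 * genHarmonicOrd 2 (2 * n + 1) x
            + 8 * (x ^ 2 + 3 * x + 3 * (n : ℂ) ^ 2 - n + 1)
                / (n * (x + 1) * (x * n + 3 * n + 1))) := by
  have hn1 : 1 ≤ n := by omega
  have h0 : (n : ℂ) ≠ 0 := by exact_mod_cast (by omega : n ≠ 0)
  have h01 : (n : ℂ) - 1 ≠ 0 := sub_ne_zero.2 (by exact_mod_cast (by omega : n ≠ 1))
  have hx1 : x + 1 ≠ 0 := by simpa using ne_zero_of_avoid_succ (k := 0) hx (by omega)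
  have h2 : x + n + 2 ≠ 0 := by
    have := ne_zero_of_avoid_succ (k := n + 1) hx (by omega)
    push_cast at this
    ring_nf at this ⊢; exact this
  have h3 : x + n + 3 ≠ 0 := by
    have := ne_zero_of_avoid_succ (k := n + 2) hx (by omega)
    push_cast at this
    ring_nf at this ⊢; exact this
  have hsum : ∑ k ∈ Finset.range (n + 1),
        ((2 * n - k).choose n : ℂ) * Ring.choose (x + (k : ℂ)) k * (k : ℂ) ^ 2
          * genHarmonic k x ^ 2
      = moment x n n 2 (fun k => genHarmonic k x ^ 2 - genHarmonicOrd 2 k x)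
        + moment x n n 2 (fun k => genHarmonicOrd 2 k x) := by
    simp only [moment, ← Finset.sum_add_distrib]
    refine Finset.sum_congr rfl fun k _ => ?_
    rw [ringChoose_eq_risingBinom, two_mul]
    ring
  rw [hsum, moment_two_genHarmonic_sq_sub hn1 hx h3, moment_two_genHarmonicOrd_two hn1 hx h3,
    ringChoose_eq_centralBinom h2 h3 hn]
  change _ = _ * (8 * _ * _ - altHarmonic n x * (altHarmonic n x - _) + _ - _ + _)
  generalize genHarmonic (n + 3) x - genHarmonic (2 * n + 1) x = A
  generalize genHarmonicOrd 2 (2 * n + 1) x = Q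
  generalize genHarmonicOrd 2 (n + 3) x = D
  generalize altHarmonic n x = B
  generalize centralBinom x n = β
  clear hx hsum
  -- Naming this denominator keeps it an atom for `field_simp`; it is expanded again for the final
  -- `ring`.
  obtain ⟨q, hq⟩ : ∃ q, x * (n : ℂ) + 3 * n + 1 = q := ⟨_, rfl⟩
  rw [hq] at hxn ⊢
  field_simp
  rw [← hq]
  ring
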